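/- Theorem (periodic parts). Let $\gamma>0$ and $\epsilon\in\mathbb R$, and consider for $m,\omega>0$ the damped Mathieu equation $m\ddot x+\gamma\dot x-\epsilon\cos(\omega t)\,x=0$ on $\mathbb R$. A Floquet solution with characteristic exponent $\lambda\in\mathbb C$ is a solution of the form $x(t)=P(t)e^{\lambda t}$ with $P\not\equiv0$ of period $2\pi/\omega$; $P$ is its periodic factor. Put $$W_{\pm}(t)=\left(\frac{\gamma^2}{4}+m\epsilon\cos(\omega t)\right)^{-1/4}e^{\pm\frac{\epsilon\sin(\omega t)}{\gamma\omega}} .$$ For every $\omega_0>0$ there is a constant $C>0$, depending only on $\gamma,\epsilon,\omega_0$, such that for every $\omega\ge\omega_0$ there is $m_0>0$ such that for all $0<m<m_0$ the following holds. One has $\gamma^2/4+m\epsilon\cos(\omega t)>0$ for all $t$. There are real characteristic exponents $\lambda_{\min}<\lambda_{\max}$ such that the real part of every characteristic exponent lies in $[\lambda_{\min},\lambda_{\max}]$. The exponent $\lambda_{\max}$ has exactly one periodic factor $P_{\max}$ with the normalization $P_{\max}(0)=W_+(0)$, and $\lambda_{\min}$ has exactly one periodic factor $P_{\min}$ with $P_{\min}(0)=W_-(0)$.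 Finally $$\sup_{t\in\mathbb R}\left|P_{\max}(t)-W_+(t)\right|\le C\,\frac m\omega,\qquad \sup_{t\in\mathbb R}\left|P_{\min}(t)-W_-(t)\right|\le C\,\frac m\omega .$$ In particular the bounds hold uniformly in time, independently of any time horizon $T$. -/

import Mathlib

/-- `x` is a (complex-valued, twice differentiable) solution on the whole line of the damped
Mathieu equation `m x'' + γ x' - ε cos(ω t) x = 0`. -/
def IsDampedMathieuSolution (m γ ε ω : ℝ) (x : ℝ → ℂ) : Prop :=
  Differentiable ℝ x ∧ Differentiable ℝ (deriv x) ∧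
    ∀ t : ℝ, (m : ℂ) * deriv (deriv x) t + (γ : ℂ) * deriv x t
      - ((ε * Real.cos (ω * t) : ℝ) : ℂ) * x t = 0

/-- `P` is the periodic factor of a Floquet solution with exponent `μ`: it is not identically
zero, has period `2π/ω`, and `t ↦ P t * exp (μ t)` solves the damped Mathieu equation. -/
structure IsFloquetFactor (m γ ε ω : ℝ) (μ : ℂ) (P : ℝ → ℂ) : Prop where
  periodic : Function.Periodic P (2 * Real.pi / ω)
  nontrivial : ∃ t, P t ≠ 0
  solution : IsDampedMathieuSolution m γ ε ω (fun t => P t * Complex.exp (μ * (t : ℂ)))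

/-- `μ` is a characteristic exponent of the damped Mathieu equation. -/
def IsCharExponent (m γ ε ω : ℝ) (μ : ℂ) : Prop :=
  ∃ P : ℝ → ℂ, IsFloquetFactor m γ ε ω μ P

/-- The real number `l` is a characteristic exponent, and no characteristic exponent has larger
real part. (Complex characteristic exponents are only determined modulo `i ω`; asking for a real
representative fixes the choice.) -/
def IsMaxExponent (m γ ε ω l : ℝ) : Prop :=
  IsCharExponent m γ ε ω (l : ℂ) ∧ ∀ μ : ℂ, IsCharExponent m γ ε ω μ → μ.re ≤ l

/-- The real number `l` is a characteristic exponent, and no characteristic exponent has smaller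
real part. -/
def IsMinExponent (m γ ε ω l : ℝ) : Prop :=
  IsCharExponent m γ ε ω (l : ℂ) ∧ ∀ μ : ℂ, IsCharExponent m γ ε ω μ → l ≤ μ.re

/-- The WKB prediction `(γ²/4 + m ε cos ωt)^(-1/4) * exp (ε sin(ωt) / (γ ω))`. -/
noncomputable def wkbMax (m γ ε ω t : ℝ) : ℝ :=
  (γ ^ 2 / 4 + m * ε * Real.cos (ω * t)) ^ (-(1 / 4) : ℝ)
    * Real.exp (ε * Real.sin (ω * t) / (γ * ω))

/-- The WKB prediction `(γ²/4 + m ε cos ωt)^(-1/4) * exp (-ε sin(ωt) / (γ ω))`. -/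
noncomputable def wkbMin (m γ ε ω t : ℝ) : ℝ :=
  (γ ^ 2 / 4 + m * ε * Real.cos (ω * t)) ^ (-(1 / 4) : ℝ)
    * Real.exp (-(ε * Real.sin (ω * t) / (γ * ω)))

/-!
The logarithmic derivative `v = x' / x` of a solution of the damped Mathieu equation satisfies the
Riccati equation `v' = (ε / m) cos (ω t) - (γ / m) v - v²`. Let `g` be the logarithmic derivative
of the WKB prediction `wkbMax`. For small `m` it satisfies this equation up to a defect that is
bounded by a constant depending on `γ` and `ε` only (`abs_wkbDefect_le`). Writing `v = g + r`, the
correction `r` solves a Riccati equation with damping `γ / m`. Inverting `d/dt + γ / m` costs a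
factor `m / γ`, so the contraction principle gives a solution `r` that has the period of the
coefficients and is `O(m)` (`exists_periodic_riccati`).

With `l` the mean of `v`, the function `exp (∫ v - l t)` is a periodic factor for the exponent `l`.
Since `g` has mean zero, its logarithm differs from that of `wkbMax` by the integral of `r` minus
its mean, which on one period is `O(m)` times the period `2π / ω`, hence `O(m / ω)`; by periodicity
the estimate holds for all times (`abs_factor_sub_wkbMax_le`).

Reduction of order by the solution `exp (∫ v)` shows that every characteristic exponent has real
part `l` or `-l - γ / m`, and that the periodic factors for `l` are multiples of one another
(`IsPeriodicRiccati.floquet_dichotomy`). As `l = O(m)`, it is the larger of the two. Finally, the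
equation with its damping removed is invariant under time reversal, which exchanges the two
exponents and the two WKB predictions, so that the claims on the minimal exponent are the claims on
the maximal one read backwards in time (`IsFloquetFactor.reverse`).
-/

/-! ### Periodic solutions of strongly damped Riccati equations -/

section Relaxation

open BoundedContinuousFunction MeasureTheory

/-- For `a > 0`, the value at `t` of the unique bounded solution of `J' = N - a J`, namely
`∫_{-∞}^t exp (-a (t - s)) N s ds`. -/
noncomputable def relaxation (a : ℝ) (N : ℝ →ᵇ ℝ) (t : ℝ) : ℝ :=
  Real.exp (-(a * t)) * ∫ s in Set.Iic t, Real.exp (a * s) * N s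

theorem integrableOn_exp_mul_bcf {a : ℝ} (ha : 0 < a) (N : ℝ →ᵇ ℝ) (t : ℝ) :
    IntegrableOn (fun s => Real.exp (a * s) * N s) (Set.Iic t) := by
  refine Integrable.mul_bdd (c := ‖N‖) (integrableOn_exp_mul_Iic ha t) ?_ ?_
  · exact N.continuous.aestronglyMeasurable
  · exact Filter.Eventually.of_forall fun s => N.norm_coe_le_norm s

theorem hasDerivAt_relaxation {a : ℝ} (ha : 0 < a) (N : ℝ →ᵇ ℝ) (t : ℝ) :
    HasDerivAt (relaxation a N) (N t - a * relaxation a N t) t := by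
  have hc : Continuous fun s => Real.exp (a * s) * N s := by fun_prop
  have hI : (fun t => ∫ s in Set.Iic t, Real.exp (a * s) * N s) = fun t =>
      (∫ s in Set.Iic (0 : ℝ), Real.exp (a * s) * N s)
        + ∫ s in (0 : ℝ)..t, Real.exp (a * s) * N s := by
    funext u
    rw [← intervalIntegral.integral_Iic_sub_Iic (integrableOn_exp_mul_bcf ha N 0)
      (integrableOn_exp_mul_bcf ha N u)]
    ring
  have h1 : HasDerivAt (fun t => ∫ s in Set.Iic t, Real.exp (a * s) * N s)
      (Real.exp (a * t) * N t) t := by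
    rw [hI]
    exact HasDerivAt.const_add _ (hc.integral_hasStrictDerivAt 0 t).hasDerivAt
  have h2 : HasDerivAt (fun t => Real.exp (-(a * t))) (Real.exp (-(a * t)) * -(a * 1)) t :=
    (((hasDerivAt_id t).const_mul a).neg).exp
  have h3 : Real.exp (-(a * t)) * Real.exp (a * t) = 1 := by
    rw [← Real.exp_add]; simp
  refine (h2.mul h1).congr_deriv ?_
  rw [relaxation]
  linear_combination N t * h3

theorem abs_relaxation_le {a : ℝ} (ha : 0 < a) (N : ℝ →ᵇ ℝ) (t : ℝ) :
    |relaxation a N t| ≤ ‖N‖ / a := by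
  have h : |∫ s in Set.Iic t, Real.exp (a * s) * N s| ≤ ‖N‖ * (Real.exp (a * t) / a) := by
    rw [← integral_exp_mul_Iic ha t, ← integral_const_mul, ← Real.norm_eq_abs]
    refine norm_integral_le_of_norm_le ((integrableOn_exp_mul_Iic ha t).const_mul _) ?_
    refine Filter.Eventually.of_forall fun s => ?_
    rw [norm_mul, Real.norm_eq_abs, Real.abs_exp, mul_comm]
    exact mul_le_mul_of_nonneg_right (N.norm_coe_le_norm s) (Real.exp_pos _).le
  have h3 : Real.exp (-(a * t)) * Real.exp (a * t) = 1 := by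
    rw [← Real.exp_add]; simp
  rw [relaxation, abs_mul, Real.abs_exp]
  calc _ ≤ Real.exp (-(a * t)) * (‖N‖ * (Real.exp (a * t) / a)) :=
        mul_le_mul_of_nonneg_left h (Real.exp_pos _).le
    _ = ‖N‖ / a := by linear_combination (‖N‖ / a) * h3

theorem relaxation_sub {a : ℝ} (ha : 0 < a) (N M : ℝ →ᵇ ℝ) (t : ℝ) :
    relaxation a (N - M) t = relaxation a N t - relaxation a M t := by
  simp only [relaxation]
  rw [← mul_sub, ← integral_sub (integrableOn_exp_mul_bcf ha N t)
    (integrableOn_exp_mul_bcf ha M t)]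
  simp only [BoundedContinuousFunction.coe_sub, Pi.sub_apply, mul_sub]

theorem relaxation_periodic {a T : ℝ} {N : ℝ →ᵇ ℝ} (hN : Function.Periodic N T) :
    Function.Periodic (relaxation a N) T := by
  intro t
  have h := (measurePreserving_add_right (volume : Measure ℝ) T).setIntegral_preimage_emb
    (measurableEmbedding_addRight T) (fun s => Real.exp (a * s) * N s) (Set.Iic (t + T))
  have hpre : (fun x : ℝ => x + T) ⁻¹' Set.Iic (t + T) = Set.Iic t := by ext; simp
  have hpt : ∀ x, Real.exp (a * (x + T)) * N (x + T)
      = Real.exp (a * T) * (Real.exp (a * x) * N x) := by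
    intro x
    rw [hN x, mul_add, Real.exp_add]; ring
  have h3 : Real.exp (-(a * (t + T))) * Real.exp (a * T) = Real.exp (-(a * t)) := by
    rw [← Real.exp_add]; ring_nf
  simp only [hpre, hpt] at h
  rw [integral_const_mul] at h
  rw [relaxation, relaxation, ← h, ← mul_assoc, h3]

/-- `relaxation a N` as a bounded continuous function. -/
noncomputable def relaxationBCF {a : ℝ} (ha : 0 < a) (N : ℝ →ᵇ ℝ) : ℝ →ᵇ ℝ :=
  BoundedContinuousFunction.ofNormedAddCommGroup (relaxation a N)
    (continuous_iff_continuousAt.2 fun t => (hasDerivAt_relaxation ha N t).continuousAt)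
    (‖N‖ / a) (abs_relaxation_le ha N)

theorem norm_relaxationBCF_le {a : ℝ} (ha : 0 < a) (N : ℝ →ᵇ ℝ) :
    ‖relaxationBCF ha N‖ ≤ ‖N‖ / a :=
  BoundedContinuousFunction.norm_ofNormedAddCommGroup_le _ (by positivity) _

theorem norm_relaxationBCF_sub_le {a : ℝ} (ha : 0 < a) (N M : ℝ →ᵇ ℝ) :
    ‖relaxationBCF ha N - relaxationBCF ha M‖ ≤ ‖N - M‖ / a := by
  have h : relaxationBCF ha N - relaxationBCF ha M = relaxationBCF ha (N - M) := by
    ext t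
    exact (relaxation_sub ha N M t).symm
  rw [h]
  exact norm_relaxationBCF_le ha _

/-- A strongly damped Riccati equation with periodic coefficients has a periodic solution of the
size of its forcing divided by the damping: it is the fixed point of
`r ↦ relaxation a (f - b r - r²)`, a contraction of the ball of radius `δ`. -/
theorem exists_periodic_riccati_bcf {a T δ : ℝ} (ha : 0 < a) (hδ : 0 ≤ δ) {b f : ℝ →ᵇ ℝ}
    (hb : Function.Periodic b T) (hf : Function.Periodic f T)
    (hball : ‖f‖ + ‖b‖ * δ + δ ^ 2 ≤ a * δ) (hcontr : ‖b‖ + 2 * δ < a) :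
    ∃ r : ℝ → ℝ, Function.Periodic r T ∧ (∀ t, |r t| ≤ δ) ∧
      ∀ t, HasDerivAt r (f t - b t * r t - r t ^ 2 - a * r t) t := by
  -- Periodicity is built into the complete set `S`, so that the fixed point inherits it.
  let Φ : (ℝ →ᵇ ℝ) → (ℝ →ᵇ ℝ) := fun r => relaxationBCF ha (f - b * r - r * r)
  let S : Set (ℝ →ᵇ ℝ) := {r | ‖r‖ ≤ δ ∧ ∀ t, r (t + T) = r t}
  have hS : IsClosed S := by
    have hper : IsClosed {r : ℝ →ᵇ ℝ | ∀ t, r (t + T) = r t} := by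
      rw [Set.ofPred_forall]
      exact isClosed_iInter fun t => isClosed_eq (by fun_prop) (by fun_prop)
    exact (isClosed_le continuous_norm continuous_const).inter hper
  have hmaps : Set.MapsTo Φ S S := by
    rintro r ⟨hr, hper⟩
    refine ⟨(norm_relaxationBCF_le ha _).trans ?_, ?_⟩
    · rw [div_le_iff₀ ha, mul_comm δ]
      refine le_trans ?_ hball
      have h1 : ‖f - b * r - r * r‖ ≤ ‖f‖ + ‖b * r‖ + ‖r * r‖ :=
        (norm_sub_le _ _).trans (add_le_add_left (norm_sub_le _ _) _)
      have h2 : ‖b * r‖ ≤ ‖b‖ * δ :=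
        (norm_mul_le _ _).trans (mul_le_mul_of_nonneg_left hr (norm_nonneg _))
      have h3 : ‖r * r‖ ≤ δ ^ 2 := by
        rw [sq]
        exact (norm_mul_le _ _).trans (mul_le_mul hr hr (norm_nonneg _) hδ)
      linarith
    · refine relaxation_periodic fun t => ?_
      have h1 := hb t
      have h2 := hf t
      have h3 := hper t
      simp [h1, h2, h3]
  have hLip : LipschitzWith (Real.toNNReal ((‖b‖ + 2 * δ) / a)) (hmaps.restrict Φ S S) := by
    refine LipschitzWith.of_dist_le_mul ?_
    rintro ⟨r, hr⟩ ⟨s, hs⟩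
    rw [Subtype.dist_eq, Subtype.dist_eq, dist_eq_norm, dist_eq_norm]
    change ‖Φ r - Φ s‖ ≤ _ * ‖r - s‖
    rw [Real.coe_toNNReal _ (by positivity)]
    refine (norm_relaxationBCF_sub_le ha _ _).trans ?_
    have he : (f - b * r - r * r) - (f - b * s - s * s) = -((b + (r + s)) * (r - s)) := by ring
    have h1 : ‖b + (r + s)‖ ≤ ‖b‖ + 2 * δ := by
      have h4 := norm_add_le b (r + s)
      have h5 := norm_add_le r s
      have h6 := hr.1
      have h7 := hs.1
      linarith
    rw [he, norm_neg, div_mul_eq_mul_div]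
    gcongr
    exact (norm_mul_le _ _).trans (mul_le_mul_of_nonneg_right h1 (norm_nonneg _))
  have hC : ContractingWith (Real.toNNReal ((‖b‖ + 2 * δ) / a)) (hmaps.restrict Φ S S) := by
    refine ⟨?_, hLip⟩
    rw [← NNReal.coe_lt_coe, Real.coe_toNNReal _ (by positivity), NNReal.coe_one]
    exact (div_lt_one ha).2 hcontr
  obtain ⟨r, hrS, hfix, -⟩ := hC.exists_fixedPoint' hS.isComplete hmaps
    (x := 0) ⟨by simpa using hδ, fun t => rfl⟩ (edist_ne_top _ _)
  refine ⟨r, hrS.2, fun t => (r.norm_coe_le_norm t).trans hrS.1, fun t => ?_⟩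
  have hrr : (relaxation a (f - b * r - r * r) : ℝ → ℝ) = r := congrArg DFunLike.coe hfix
  have h := hasDerivAt_relaxation ha (f - b * r - r * r) t
  rw [hrr] at h
  refine h.congr_deriv ?_
  simp only [BoundedContinuousFunction.coe_sub, BoundedContinuousFunction.coe_mul, Pi.sub_apply,
    Pi.mul_apply]
  ring

theorem exists_periodic_riccati {a T δ B F : ℝ} (ha : 0 < a) (hδ : 0 ≤ δ) {b f : ℝ → ℝ}
    (hbc : Continuous b) (hfc : Continuous f)
    (hb : Function.Periodic b T) (hf : Function.Periodic f T)
    (hbB : ∀ t, |b t| ≤ B) (hfF : ∀ t, |f t| ≤ F)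
    (hball : F + B * δ + δ ^ 2 ≤ a * δ) (hcontr : B + 2 * δ < a) :
    ∃ r : ℝ → ℝ, Function.Periodic r T ∧ (∀ t, |r t| ≤ δ) ∧
      ∀ t, HasDerivAt r (f t - b t * r t - r t ^ 2 - a * r t) t := by
  have hB : 0 ≤ B := (abs_nonneg _).trans (hbB 0)
  have hF : 0 ≤ F := (abs_nonneg _).trans (hfF 0)
  have hnb := norm_ofNormedAddCommGroup_le hbc hB hbB
  have hnf := norm_ofNormedAddCommGroup_le hfc hF hfF
  refine exists_periodic_riccati_bcf (b := ofNormedAddCommGroup b hbc B hbB)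
    (f := ofNormedAddCommGroup f hfc F hfF) ha hδ hb hf ?_ ?_
  · refine le_trans ?_ hball
    gcongr
  · linarith

end Relaxation

/-! ### Floquet solutions and the Riccati equation -/

/-- `v` is a periodic solution, with mean value `l`, of the Riccati equation
`v' = (ε / m) cos (ω t) - (γ / m) v - v²` satisfied by the logarithmic derivatives of the
solutions of the damped Mathieu equation. -/
structure IsPeriodicRiccati (m γ ε ω l : ℝ) (v : ℝ → ℝ) : Prop where
  periodic : Function.Periodic v (2 * Real.pi / ω)
  hasDerivAt : ∀ t, HasDerivAt v (ε * Real.cos (ω * t) / m - γ / m * v t - v t ^ 2) t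
  mean : ∫ s in (0 : ℝ)..(2 * Real.pi / ω), v s = l * (2 * Real.pi / ω)

theorem eq_zero_of_exp_mul_eq_self {z w : ℂ} {T : ℝ} (hT : 0 < T) (hz : z ≠ 0)
    (h : z * Complex.exp (w * T) = z) : w.re = 0 := by
  have h1 : Complex.exp (w * T) = 1 := by
    simpa [hz] using h
  have h2 := congrArg norm h1
  rw [Complex.norm_exp, norm_one, Real.exp_eq_one_iff, Complex.re_mul_ofReal] at h2
  exact (mul_eq_zero.1 h2).resolve_right hT.ne'

theorem hasDerivAt_cexp_ofReal {f : ℝ → ℝ} {f' t : ℝ} (hf : HasDerivAt f f' t) :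
    HasDerivAt (fun t => Complex.exp (f t : ℂ)) (Complex.exp (f t : ℂ) * (f' : ℂ)) t :=
  hf.ofReal_comp.cexp

namespace IsPeriodicRiccati

variable {m γ ε ω l : ℝ} {v : ℝ → ℝ}

theorem continuous (hv : IsPeriodicRiccati m γ ε ω l v) : Continuous v :=
  continuous_iff_continuousAt.2 fun t => (hv.hasDerivAt t).continuousAt

theorem hasDerivAt_integral (hv : IsPeriodicRiccati m γ ε ω l v) (t : ℝ) :
    HasDerivAt (fun t => ∫ s in (0 : ℝ)..t, v s) (v t) t :=
  (hv.continuous.integral_hasStrictDerivAt 0 t).hasDerivAt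

theorem integral_add_period (hv : IsPeriodicRiccati m γ ε ω l v) (t : ℝ) :
    ∫ s in (0 : ℝ)..(t + 2 * Real.pi / ω), v s
      = (∫ s in (0 : ℝ)..t, v s) + l * (2 * Real.pi / ω) := by
  have h := hv.continuous.intervalIntegrable (μ := MeasureTheory.volume)
  rw [← intervalIntegral.integral_add_adjacent_intervals (h 0 t) (h t _),
    hv.periodic.intervalIntegral_add_eq t 0, zero_add, hv.mean]

theorem isFloquetFactor (hv : IsPeriodicRiccati m γ ε ω l v) (hm : 0 < m) {c : ℝ} (hc : c ≠ 0) :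
    IsFloquetFactor m γ ε ω (l : ℂ)
      (fun t => ((c * Real.exp ((∫ s in (0 : ℝ)..t, v s) - l * t) : ℝ) : ℂ)) := by
  refine ⟨fun t => ?_, ⟨0, by simpa using hc⟩, ?_⟩
  · rw [hv.integral_add_period]
    ring_nf
  · have hx : (fun t : ℝ => ((c * Real.exp ((∫ s in (0 : ℝ)..t, v s) - l * t) : ℝ) : ℂ)
        * Complex.exp ((l : ℂ) * (t : ℂ)))
        = fun t => (c : ℂ) * Complex.exp ((∫ s in (0 : ℝ)..t, v s : ℝ) : ℂ) := by
      funext t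
      rw [Complex.ofReal_mul, Complex.ofReal_exp, mul_assoc, ← Complex.exp_add]
      push_cast
      ring_nf
    rw [hx]
    have h1 : ∀ t : ℝ, HasDerivAt
        (fun t : ℝ => (c : ℂ) * Complex.exp ((∫ s in (0 : ℝ)..t, v s : ℝ) : ℂ))
        ((c : ℂ) * Complex.exp ((∫ s in (0 : ℝ)..t, v s : ℝ) : ℂ) * (v t : ℂ)) t := by
      intro t
      refine ((hasDerivAt_cexp_ofReal (hv.hasDerivAt_integral t)).const_mul (c : ℂ)).congr_deriv ?_
      ring
    have h2 := fun t => (h1 t).mul (hv.hasDerivAt t).ofReal_comp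
    have hd := funext fun t => (h1 t).deriv
    refine ⟨fun t => (h1 t).differentiableAt, ?_, fun t => ?_⟩
    · rw [hd]
      exact fun t => (h2 t).differentiableAt
    · rw [hd]
      have h3 := (h2 t).deriv
      simp only [Pi.mul_def] at h3
      rw [h3]
      have hm' : (m : ℂ) ≠ 0 := by exact_mod_cast hm.ne'
      push_cast
      field_simp
      ring

/-- Reduction of order. If `x = P exp (μ t)` is a Floquet solution, then `z = x' - v x` solves
`z' = -(γ / m + v) z`. Either `z` vanishes, and `x` is a multiple of `exp (∫ v)`; or `z` does not,
and comparing its growth over one period with that of `x` gives the real part of `μ`. -/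
theorem floquet_dichotomy (hv : IsPeriodicRiccati m γ ε ω l v) (hm : 0 < m) (hω : 0 < ω)
    {μ : ℂ} {P : ℝ → ℂ} (hP : IsFloquetFactor m γ ε ω μ P) :
    (μ.re = l ∧ ∀ t : ℝ, P t = P 0 * Complex.exp (((∫ s in (0 : ℝ)..t, v s) : ℝ) - μ * t))
      ∨ μ.re = -l - γ / m := by
  have hT : 0 < 2 * Real.pi / ω := by positivity
  set T := 2 * Real.pi / ω with hTdef
  have hm' : (m : ℂ) ≠ 0 := by exact_mod_cast hm.ne'
  obtain ⟨hx, hx', hode⟩ := hP.solution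
  set x : ℝ → ℂ := fun t => P t * Complex.exp (μ * (t : ℂ)) with hxdef
  have hxT : ∀ t, x (t + T) = Complex.exp (μ * T) * x t := by
    intro t
    simp only [hxdef]
    rw [hP.periodic t]
    push_cast
    rw [mul_add, Complex.exp_add]
    ring
  have hxT' : ∀ t, deriv x (t + T) = Complex.exp (μ * T) * deriv x t := by
    intro t
    rw [← deriv_comp_add_const]
    simp only [hxT]
    exact deriv_const_mul _ (hx t)
  let I : ℝ → ℝ := fun t => ∫ s in (0 : ℝ)..t, v s
  have hI : ∀ t, HasDerivAt I (v t) t := hv.hasDerivAt_integral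
  have hI0 : I 0 = 0 := intervalIntegral.integral_same
  have hIT : I T = l * T := hv.mean
  let z : ℝ → ℂ := fun t => deriv x t - v t * x t
  have hz : ∀ t, HasDerivAt z (-((γ / m + v t : ℝ) : ℂ) * z t) t := by
    intro t
    have h1 := (hx' t).hasDerivAt.sub ((hv.hasDerivAt t).ofReal_comp.mul (hx t).hasDerivAt)
    refine h1.congr_deriv ?_
    have h2 := hode t
    have h3 : deriv (deriv x) t
        = (((ε * Real.cos (ω * t) : ℝ) : ℂ) * x t - (γ : ℂ) * deriv x t) / m := by
      rw [eq_div_iff hm']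
      linear_combination h2
    rw [h3]
    simp only [z]
    push_cast
    field_simp
    ring
  have hzconst : ∀ t, z t * Complex.exp ((γ / m * t + I t : ℝ) : ℂ) = z 0 := by
    intro t
    have hd : ∀ t, HasDerivAt (fun t => z t * Complex.exp ((γ / m * t + I t : ℝ) : ℂ)) 0 t := by
      intro t
      have h1 := hasDerivAt_cexp_ofReal (((hasDerivAt_id t).const_mul (γ / m)).add (hI t))
      refine ((hz t).mul h1).congr_deriv ?_
      simp only [Pi.add_apply, id]
      push_cast
      ring
    have h := is_const_of_deriv_eq_zero (fun t => (hd t).differentiableAt)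
      (fun t => (hd t).deriv) t 0
    simpa [hI0] using h
  -- By `hzconst`, `z` vanishes identically as soon as `z 0 = 0`.
  by_cases hz0 : z 0 = 0
  · left
    have hzero : ∀ t, deriv x t = v t * x t := by
      intro t
      have h := hzconst t
      rw [hz0, mul_eq_zero, or_iff_left (Complex.exp_ne_zero _)] at h
      exact sub_eq_zero.1 h
    have hxconst : ∀ t, x t * Complex.exp ((-I t : ℝ) : ℂ) = x 0 := by
      intro t
      have hd : ∀ t, HasDerivAt (fun t => x t * Complex.exp ((-I t : ℝ) : ℂ)) 0 t := by
        intro t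
        have h1 := hasDerivAt_cexp_ofReal (hI t).neg
        refine ((hx t).hasDerivAt.mul h1).congr_deriv ?_
        rw [hzero t]
        simp only [Pi.neg_apply]
        push_cast
        ring
      have h := is_const_of_deriv_eq_zero (fun t => (hd t).differentiableAt)
        (fun t => (hd t).deriv) t 0
      simpa [hI0] using h
    have hPt : ∀ t : ℝ, P t = P 0 * Complex.exp ((I t : ℝ) - μ * t) := by
      intro t
      have h := hxconst t
      simp only [hxdef, Complex.ofReal_zero, mul_zero, Complex.exp_zero, mul_one] at h
      have he : Complex.exp (μ * t) * Complex.exp ((-I t : ℝ) : ℂ)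
          * Complex.exp ((I t : ℝ) - μ * t) = 1 := by
        rw [← Complex.exp_add, ← Complex.exp_add, ← Complex.exp_zero]
        push_cast
        ring_nf
      rw [← h]
      linear_combination -(P t) * he
    have hP0 : P 0 ≠ 0 := by
      intro h
      obtain ⟨t, ht⟩ := hP.nontrivial
      exact ht (by rw [hPt t, h, zero_mul])
    refine ⟨?_, hPt⟩
    have h1 : P 0 * Complex.exp (((l : ℂ) - μ) * T) = P 0 := by
      have h2 := hPt T
      have h3 := hP.periodic 0
      rw [← hTdef, zero_add] at h3
      rw [h3, hIT] at h2
      convert h2.symm using 3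
      push_cast
      ring
    have h4 := eq_zero_of_exp_mul_eq_self hT hP0 h1
    simp only [Complex.sub_re, Complex.ofReal_re] at h4
    linarith
  · right
    have h1 : z T = Complex.exp (μ * T) * z 0 := by
      have h2 := hxT 0
      have h3 := hxT' 0
      have h4 := hv.periodic 0
      rw [← hTdef] at h4
      rw [zero_add] at h2 h3 h4
      simp only [z]
      rw [h2, h3, h4]
      ring
    have h5 : z 0 * Complex.exp ((μ + (γ / m + l : ℝ)) * T) = z 0 := by
      have h6 := hzconst T
      rw [h1, hIT] at h6
      have h7 : Complex.exp ((μ + (γ / m + l : ℝ)) * T)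
          = Complex.exp (μ * T) * Complex.exp ((γ / m * T + l * T : ℝ) : ℂ) := by
        rw [← Complex.exp_add]
        push_cast
        ring_nf
      rw [h7]
      linear_combination h6
    have h8 := eq_zero_of_exp_mul_eq_self hT hz0 h5
    simp only [Complex.add_re, Complex.ofReal_re] at h8
    linarith

end IsPeriodicRiccati

/-! ### Time reversal -/

/-- Time reversal. Removing the damping by `x = exp (-γ t / (2 m)) y` leaves an equation for `y`
that is even in `t`, so that `y (-t)` is a solution together with `y t`. -/
theorem IsFloquetFactor.comp_neg {m γ ε ω : ℝ} {μ : ℂ} {P : ℝ → ℂ} (hm : 0 < m)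
    (hP : IsFloquetFactor m γ ε ω μ P) :
    IsFloquetFactor m γ ε ω (-μ - γ / m) (fun t => P (-t)) := by
  have hm' : (m : ℂ) ≠ 0 := by exact_mod_cast hm.ne'
  refine ⟨fun t => ?_, ?_, ?_⟩
  · have h := hP.periodic (-(t + 2 * Real.pi / ω))
    change P (-(t + 2 * Real.pi / ω)) = P (-t)
    rw [← h]
    ring_nf
  · obtain ⟨t, ht⟩ := hP.nontrivial
    exact ⟨-t, by simpa using ht⟩
  · obtain ⟨hx, hx', hode⟩ := hP.solution
    set x : ℝ → ℂ := fun t => P t * Complex.exp (μ * (t : ℂ)) with hxdef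
    set k : ℂ := -(γ / m : ℝ) with hk
    have hy : (fun t : ℝ => P (-t) * Complex.exp ((-μ - γ / m) * (t : ℂ)))
        = fun t : ℝ => x (-t) * Complex.exp (k * (t : ℂ)) := by
      funext t
      simp only [hxdef, hk]
      rw [mul_assoc, ← Complex.exp_add]
      push_cast
      ring_nf
    rw [hy]
    have he : ∀ t : ℝ, HasDerivAt (fun t : ℝ => Complex.exp (k * (t : ℂ)))
        (Complex.exp (k * (t : ℂ)) * k) t := by
      intro t
      simpa using ((hasDerivAt_id t).ofReal_comp.const_mul k).cexp
    have hn : ∀ {f : ℝ → ℂ}, Differentiable ℝ f → ∀ t : ℝ,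
        HasDerivAt (fun t => f (-t)) (-deriv f (-t)) t := by
      intro f hf t
      simpa [Function.comp_def] using (hf (-t)).hasDerivAt.scomp t (hasDerivAt_neg t)
    have h1 := fun t => (hn hx t).mul (he t)
    have h1' : ∀ t, HasDerivAt (fun t : ℝ => x (-t) * Complex.exp (k * (t : ℂ)))
        ((k * x (-t) - deriv x (-t)) * Complex.exp (k * (t : ℂ))) t := fun t =>
      (h1 t).congr_deriv (by ring)
    have h2 : ∀ t, HasDerivAt
        (fun t : ℝ => (k * x (-t) - deriv x (-t)) * Complex.exp (k * (t : ℂ))) _ t := fun t =>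
      (((hn hx t).const_mul k).sub (hn hx' t)).mul (he t)
    have hd := funext fun t => (h1' t).deriv
    refine ⟨fun t => (h1' t).differentiableAt, ?_, fun t => ?_⟩
    · rw [hd]
      exact fun t => (h2 t).differentiableAt
    · rw [hd, (h2 t).deriv]
      have h3 := hode (-t)
      rw [mul_neg, Real.cos_neg] at h3
      simp only [Pi.sub_apply]
      have h4 : (m : ℂ) * k = -γ := by
        rw [hk]; push_cast; field_simp
      linear_combination (Complex.exp (k * (t : ℂ))) * h3
        + Complex.exp (k * (t : ℂ)) * (k * x (-t) - 2 * deriv x (-t)) * h4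

/-! ### The WKB prediction as an approximate solution -/

/-- The logarithm of the WKB prediction `wkbMax`. -/
noncomputable def wkbLog (m γ ε ω t : ℝ) : ℝ :=
  -(1 / 4) * Real.log (γ ^ 2 / 4 + m * ε * Real.cos (ω * t)) + ε * Real.sin (ω * t) / (γ * ω)

/-- The logarithmic derivative of the WKB prediction `wkbMax`. -/
noncomputable def wkbSlope (m γ ε ω t : ℝ) : ℝ :=
  ε * Real.cos (ω * t) / γ
    + m * ε * ω * Real.sin (ω * t) / (4 * (γ ^ 2 / 4 + m * ε * Real.cos (ω * t)))

/-- The defect `(ε / m) cos (ω t) - (γ / m) g - g² - g'` of `g = wkbSlope` in the Riccati equation,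
in a form where the terms of size `1 / m` have cancelled, and where the terms of size `ω` coming
from `g'` and from the damping have been combined into one of size `m ω`. -/
noncomputable def wkbDefect (m γ ε ω t : ℝ) : ℝ :=
  m * ε ^ 2 * ω * Real.sin (ω * t) * Real.cos (ω * t)
      / (γ * (γ ^ 2 / 4 + m * ε * Real.cos (ω * t)))
    - m * ε * ω ^ 2 * Real.cos (ω * t) / (4 * (γ ^ 2 / 4 + m * ε * Real.cos (ω * t)))
    - (m * ε * ω * Real.sin (ω * t)) ^ 2 / (4 * (γ ^ 2 / 4 + m * ε * Real.cos (ω * t)) ^ 2)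
    - wkbSlope m γ ε ω t ^ 2

section WKB

variable {m γ ε ω : ℝ}

theorem periodic_of_cos_sin {α : Type*} (hω : 0 < ω) (φ : ℝ → ℝ → α) :
    Function.Periodic (fun t => φ (Real.cos (ω * t)) (Real.sin (ω * t))) (2 * Real.pi / ω) := by
  intro t
  have h : ω * (t + 2 * Real.pi / ω) = ω * t + 2 * Real.pi := by field_simp
  simp only [h, Real.cos_add_two_pi, Real.sin_add_two_pi]

theorem discriminant_lower_bound (hm : 0 < m) (h1 : m * |ε| ≤ γ ^ 2 / 8) (t : ℝ) :
    γ ^ 2 / 8 ≤ γ ^ 2 / 4 + m * ε * Real.cos (ω * t) := by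
  have h : |m * ε * Real.cos (ω * t)| ≤ γ ^ 2 / 8 := by
    rw [abs_mul, abs_mul, abs_of_pos hm]
    exact (mul_le_of_le_one_right (by positivity) (Real.abs_cos_le_one _)).trans h1
  have := neg_le_of_abs_le h
  linarith

theorem hasDerivAt_discriminant (t : ℝ) :
    HasDerivAt (fun t => γ ^ 2 / 4 + m * ε * Real.cos (ω * t))
      (-(m * ε * ω * Real.sin (ω * t))) t := by
  have h := (((hasDerivAt_id t).const_mul ω).cos.const_mul (m * ε)).const_add (γ ^ 2 / 4)
  simp only [id] at h
  exact h.congr_deriv (by ring)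

theorem hasDerivAt_sin_mul (t : ℝ) :
    HasDerivAt (fun t => Real.sin (ω * t)) (ω * Real.cos (ω * t)) t := by
  have h := ((hasDerivAt_id t).const_mul ω).sin
  simp only [id] at h
  exact h.congr_deriv (by ring)

theorem hasDerivAt_cos_mul (t : ℝ) :
    HasDerivAt (fun t => Real.cos (ω * t)) (-(ω * Real.sin (ω * t))) t := by
  have h := ((hasDerivAt_id t).const_mul ω).cos
  simp only [id] at h
  exact h.congr_deriv (by ring)

theorem wkbMax_eq_exp {t : ℝ} (hQ : 0 < γ ^ 2 / 4 + m * ε * Real.cos (ω * t)) :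
    wkbMax m γ ε ω t = Real.exp (wkbLog m γ ε ω t) := by
  rw [wkbMax, wkbLog, Real.exp_add, Real.rpow_def_of_pos hQ, mul_comm (-(1 / 4) : ℝ)]

theorem wkbMin_eq_wkbMax_neg (t : ℝ) : wkbMin m γ ε ω t = wkbMax m γ ε ω (-t) := by
  simp [wkbMin, wkbMax, neg_div]

theorem hasDerivAt_wkbLog (hγ : 0 < γ) (hω : 0 < ω) {t : ℝ}
    (hQ : 0 < γ ^ 2 / 4 + m * ε * Real.cos (ω * t)) :
    HasDerivAt (wkbLog m γ ε ω) (wkbSlope m γ ε ω t) t := by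
  have h := (((hasDerivAt_discriminant (γ := γ) (m := m) (ε := ε) (ω := ω) t).log
    hQ.ne').const_mul (-(1 / 4))).add
      (((hasDerivAt_sin_mul (ω := ω) t).const_mul ε).div_const (γ * ω))
  refine h.congr_deriv ?_
  rw [wkbSlope]
  field_simp
  ring

theorem continuous_wkbSlope (hQ : ∀ t, 0 < γ ^ 2 / 4 + m * ε * Real.cos (ω * t)) :
    Continuous (wkbSlope m γ ε ω) := by
  unfold wkbSlope
  refine Continuous.add (by fun_prop) (Continuous.div (by fun_prop) (by fun_prop) fun t => ?_)
  have := hQ t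
  positivity

theorem continuous_wkbDefect (hγ : 0 < γ) (hQ : ∀ t, 0 < γ ^ 2 / 4 + m * ε * Real.cos (ω * t)) :
    Continuous (wkbDefect m γ ε ω) := by
  unfold wkbDefect
  refine Continuous.sub (Continuous.sub (Continuous.sub ?_ ?_) ?_)
    ((continuous_wkbSlope hQ).pow 2)
  all_goals
    refine Continuous.div (by fun_prop) (by fun_prop) fun t => ?_
    have := hQ t
    positivity

theorem hasDerivAt_wkbSlope (hm : 0 < m) (hγ : 0 < γ) {t : ℝ}
    (hQ : 0 < γ ^ 2 / 4 + m * ε * Real.cos (ω * t)) :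
    HasDerivAt (wkbSlope m γ ε ω) (ε * Real.cos (ω * t) / m - γ / m * wkbSlope m γ ε ω t
      - wkbSlope m γ ε ω t ^ 2 - wkbDefect m γ ε ω t) t := by
  have h := (((hasDerivAt_cos_mul (ω := ω) t).const_mul ε).div_const γ).add
    (((hasDerivAt_sin_mul (ω := ω) t).const_mul (m * ε * ω)).div
      ((hasDerivAt_discriminant (γ := γ) (m := m) (ε := ε) (ω := ω) t).const_mul 4)
      (by positivity))
  refine h.congr_deriv ?_
  rw [wkbDefect, wkbSlope]
  generalize hq : γ ^ 2 / 4 + m * ε * Real.cos (ω * t) = Q at hQ ⊢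
  have hc : m * ε * Real.cos (ω * t) = Q - γ ^ 2 / 4 := by rw [← hq]; ring
  generalize Real.cos (ω * t) = c at *
  generalize Real.sin (ω * t) = s at *
  have h1 : m * ε ^ 2 * ω * s * c / (γ * Q) = ε * ω * s / γ - γ * ε * ω * s / (4 * Q) := by
    rw [show m * ε ^ 2 * ω * s * c = ε * ω * s * (m * ε * c) by ring, hc]
    field_simp
  rw [h1]
  field_simp
  ring

theorem abs_mul_le_of_abs_le_one {a x : ℝ} (hx : |x| ≤ 1) : |a * x| ≤ |a| := by
  rw [abs_mul]
  exact mul_le_of_le_one_right (abs_nonneg _) hx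

theorem abs_wkbSlope_le (hm : 0 < m) (hγ : 0 < γ) (hω : 0 < ω) (h1 : m * |ε| ≤ γ ^ 2 / 8)
    (t : ℝ) : |wkbSlope m γ ε ω t| ≤ |ε| / γ + m * (2 * |ε| * ω / γ ^ 2) := by
  have hQ := discriminant_lower_bound (ω := ω) hm h1 t
  rw [wkbSlope]
  generalize γ ^ 2 / 4 + m * ε * Real.cos (ω * t) = Q at *
  have hγ2 : 0 < γ ^ 2 / 8 := by positivity
  have hQ0 : 0 < Q := hγ2.trans_le hQ
  refine (abs_add_le _ _).trans (add_le_add ?_ ?_)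
  · rw [abs_div, abs_of_pos hγ]
    exact div_le_div_of_nonneg_right (abs_mul_le_of_abs_le_one (Real.abs_cos_le_one _)) hγ.le
  · rw [abs_div, abs_of_pos (a := 4 * Q) (by positivity)]
    calc _ ≤ (m * |ε| * ω) / (4 * (γ ^ 2 / 8)) := by
          gcongr
          refine (abs_mul_le_of_abs_le_one (Real.abs_sin_le_one _)).trans_eq ?_
          rw [abs_mul, abs_mul, abs_of_pos hm, abs_of_pos hω]
      _ = _ := by field_simp; ring

theorem abs_wkbDefect_le (hm : 0 < m) (hγ : 0 < γ) (hω : 0 < ω) (h1 : m * |ε| ≤ γ ^ 2 / 8)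
    (t : ℝ) : |wkbDefect m γ ε ω t| ≤
      m * (8 * ε ^ 2 * ω / γ ^ 3 + 2 * |ε| * ω ^ 2 / γ ^ 2 + m * (16 * ε ^ 2 * ω ^ 2 / γ ^ 4))
        + |wkbSlope m γ ε ω t| ^ 2 := by
  have hQ := discriminant_lower_bound (ω := ω) hm h1 t
  rw [wkbDefect]
  generalize γ ^ 2 / 4 + m * ε * Real.cos (ω * t) = Q at *
  have hγ2 : 0 < γ ^ 2 / 8 := by positivity
  have hQ0 : 0 < Q := hγ2.trans_le hQ
  have hc := Real.abs_cos_le_one (ω * t)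
  have hs := Real.abs_sin_le_one (ω * t)
  have e1 : |m * ε ^ 2 * ω * Real.sin (ω * t) * Real.cos (ω * t) / (γ * Q)|
      ≤ m * (8 * ε ^ 2 * ω / γ ^ 3) := by
    rw [abs_div, abs_of_pos (a := γ * Q) (by positivity)]
    calc _ ≤ (m * ε ^ 2 * ω) / (γ * (γ ^ 2 / 8)) := by
          gcongr
          refine (abs_mul_le_of_abs_le_one hc).trans
            ((abs_mul_le_of_abs_le_one hs).trans_eq ?_)
          exact abs_of_nonneg (by positivity)
      _ = _ := by field_simp
  have e2 : |m * ε * ω ^ 2 * Real.cos (ω * t) / (4 * Q)| ≤ m * (2 * |ε| * ω ^ 2 / γ ^ 2) := by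
    rw [abs_div, abs_of_pos (a := 4 * Q) (by positivity)]
    calc _ ≤ (m * |ε| * ω ^ 2) / (4 * (γ ^ 2 / 8)) := by
          gcongr
          refine (abs_mul_le_of_abs_le_one hc).trans_eq ?_
          rw [abs_mul, abs_mul, abs_of_pos hm, abs_of_pos (pow_pos hω 2)]
      _ = _ := by field_simp; ring
  have e3 : |(m * ε * ω * Real.sin (ω * t)) ^ 2 / (4 * Q ^ 2)|
      ≤ m * (m * (16 * ε ^ 2 * ω ^ 2 / γ ^ 4)) := by
    rw [abs_div, abs_of_pos (a := 4 * Q ^ 2) (by positivity), abs_pow]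
    calc _ ≤ |m * ε * ω| ^ 2 / (4 * (γ ^ 2 / 8) ^ 2) := by
          have := abs_mul_le_of_abs_le_one (a := m * ε * ω) hs
          gcongr ?_ ^ 2 / (4 * ?_ ^ 2)
      _ = _ := by rw [sq_abs]; field_simp; ring
  have e4 := abs_sub (m * ε ^ 2 * ω * Real.sin (ω * t) * Real.cos (ω * t) / (γ * Q)
    - m * ε * ω ^ 2 * Real.cos (ω * t) / (4 * Q)
    - (m * ε * ω * Real.sin (ω * t)) ^ 2 / (4 * Q ^ 2)) (wkbSlope m γ ε ω t ^ 2)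
  have e5 := abs_sub (m * ε ^ 2 * ω * Real.sin (ω * t) * Real.cos (ω * t) / (γ * Q)
    - m * ε * ω ^ 2 * Real.cos (ω * t) / (4 * Q))
    ((m * ε * ω * Real.sin (ω * t)) ^ 2 / (4 * Q ^ 2))
  have e6 := abs_sub (m * ε ^ 2 * ω * Real.sin (ω * t) * Real.cos (ω * t) / (γ * Q))
    (m * ε * ω ^ 2 * Real.cos (ω * t) / (4 * Q))
  rw [← abs_pow]
  linarith

theorem integral_wkbSlope (hγ : 0 < γ) (hω : 0 < ω)
    (hQ : ∀ t, 0 < γ ^ 2 / 4 + m * ε * Real.cos (ω * t)) (t : ℝ) :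
    ∫ s in (0 : ℝ)..t, wkbSlope m γ ε ω s = wkbLog m γ ε ω t - wkbLog m γ ε ω 0 :=
  intervalIntegral.integral_eq_sub_of_hasDerivAt (fun s _ => hasDerivAt_wkbLog hγ hω (hQ s))
    ((continuous_wkbSlope hQ).intervalIntegrable _ _)

theorem periodic_wkbLog (hω : 0 < ω) :
    Function.Periodic (wkbLog m γ ε ω) (2 * Real.pi / ω) :=
  periodic_of_cos_sin hω fun c s => -(1 / 4) * Real.log (γ ^ 2 / 4 + m * ε * c) + ε * s / (γ * ω)

theorem periodic_wkbSlope (hω : 0 < ω) :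
    Function.Periodic (wkbSlope m γ ε ω) (2 * Real.pi / ω) :=
  periodic_of_cos_sin hω fun c s =>
    ε * c / γ + m * ε * ω * s / (4 * (γ ^ 2 / 4 + m * ε * c))

theorem periodic_wkbDefect (hω : 0 < ω) :
    Function.Periodic (wkbDefect m γ ε ω) (2 * Real.pi / ω) :=
  periodic_of_cos_sin hω fun c s => m * ε ^ 2 * ω * s * c / (γ * (γ ^ 2 / 4 + m * ε * c))
    - m * ε * ω ^ 2 * c / (4 * (γ ^ 2 / 4 + m * ε * c))
    - (m * ε * ω * s) ^ 2 / (4 * (γ ^ 2 / 4 + m * ε * c) ^ 2)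
    - (ε * c / γ + m * ε * ω * s / (4 * (γ ^ 2 / 4 + m * ε * c))) ^ 2

/-- This bound, through its exponential factor, is where a lower bound on the frequencies is used. -/
theorem wkbMax_le (hm : 0 < m) (hγ : 0 < γ) {ω₀ : ℝ} (hω₀ : 0 < ω₀) (hω : ω₀ ≤ ω)
    (h1 : m * |ε| ≤ γ ^ 2 / 8) (t : ℝ) :
    wkbMax m γ ε ω t ≤ (γ ^ 2 / 8) ^ (-(1 / 4) : ℝ) * Real.exp (|ε| / (γ * ω₀)) := by
  have hQ := discriminant_lower_bound (ω := ω) hm h1 t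
  have hγ2 : 0 < γ ^ 2 / 8 := by positivity
  have hω' : 0 < ω := hω₀.trans_le hω
  rw [wkbMax]
  refine mul_le_mul (Real.rpow_le_rpow_of_nonpos hγ2 hQ (by norm_num)) ?_ (Real.exp_pos _).le
    (by positivity)
  refine Real.exp_le_exp.2 ((le_abs_self _).trans ?_)
  rw [abs_div, abs_of_pos (a := γ * ω) (by positivity)]
  exact div_le_div₀ (abs_nonneg _) (abs_mul_le_of_abs_le_one (Real.abs_sin_le_one _))
    (by positivity) (by gcongr)

/-- The Riccati equation has a periodic solution close to `wkbSlope`. The correction `r` solves a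
Riccati equation with damping `γ / m` and forcing `wkbDefect`. -/
theorem exists_isPeriodicRiccati {F G δ : ℝ} (hm : 0 < m) (hγ : 0 < γ) (hω : 0 < ω) (hδ : 0 ≤ δ)
    (h1 : m * |ε| ≤ γ ^ 2 / 8) (hG : ∀ t, |wkbSlope m γ ε ω t| ≤ G)
    (hF : ∀ t, |wkbDefect m γ ε ω t| ≤ F)
    (hball : F + 2 * G * δ + δ ^ 2 ≤ γ / m * δ) (hcontr : 2 * G + 2 * δ < γ / m) :
    ∃ (r : ℝ → ℝ) (l : ℝ), Continuous r ∧ (∀ t, |r t| ≤ δ) ∧ |l| ≤ δ ∧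
      IsPeriodicRiccati m γ ε ω l (fun t => wkbSlope m γ ε ω t + r t) := by
  have hγ2 : 0 < γ ^ 2 / 8 := by positivity
  have hQ : ∀ t, 0 < γ ^ 2 / 4 + m * ε * Real.cos (ω * t) := fun t =>
    hγ2.trans_le (discriminant_lower_bound hm h1 t)
  have hT : 0 < 2 * Real.pi / ω := by positivity
  obtain ⟨r, hrper, hrδ, hr⟩ := exists_periodic_riccati (a := γ / m) (T := 2 * Real.pi / ω)
    (b := fun t => 2 * wkbSlope m γ ε ω t) (f := wkbDefect m γ ε ω) (by positivity) hδ
    ((continuous_wkbSlope hQ).const_mul 2) (continuous_wkbDefect hγ hQ)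
    (fun t => by simp only [periodic_wkbSlope hω t]) (periodic_wkbDefect hω)
    (fun t => by rw [abs_mul, abs_two]; exact mul_le_mul_of_nonneg_left (hG t) zero_le_two)
    hF hball hcontr
  have hrc : Continuous r := continuous_iff_continuousAt.2 fun t => (hr t).continuousAt
  refine ⟨r, (∫ s in (0 : ℝ)..(2 * Real.pi / ω), r s) / (2 * Real.pi / ω), hrc, hrδ, ?_,
    fun t => ?_, fun t => ?_, ?_⟩
  · rw [abs_div, abs_of_pos hT, div_le_iff₀ hT]
    have h := intervalIntegral.norm_integral_le_of_norm_le_const (a := 0) (b := 2 * Real.pi / ω)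
      (f := r) fun t _ => hrδ t
    rwa [sub_zero, abs_of_pos hT] at h
  · simp only [periodic_wkbSlope hω t, hrper t]
  · exact ((hasDerivAt_wkbSlope hm hγ (hQ t)).add (hr t)).congr_deriv (by ring)
  · rw [intervalIntegral.integral_add ((continuous_wkbSlope hQ).intervalIntegrable _ _)
      (hrc.intervalIntegrable _ _), integral_wkbSlope hγ hω hQ, (periodic_wkbLog hω).eq, sub_self,
      zero_add, div_mul_cancel₀ _ hT.ne']

end WKB

/-! ### Extremal exponents and their periodic factors -/

section Extremal

variable {m γ ε ω l : ℝ} {v : ℝ → ℝ}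

/-- As `l` differs from `-l - γ / m`, the second alternative of the dichotomy is excluded, so the
periodic factors with exponent `l` are the multiples of a single one. -/
theorem IsPeriodicRiccati.factor_eq (hv : IsPeriodicRiccati m γ ε ω l v) (hm : 0 < m)
    (hω : 0 < ω) (hl : -l - γ / m < l) {c : ℝ} {P : ℝ → ℂ}
    (hP : IsFloquetFactor m γ ε ω (l : ℂ) P) (hc : P 0 = c) :
    P = fun t => ((c * Real.exp ((∫ s in (0 : ℝ)..t, v s) - l * t) : ℝ) : ℂ) := by
  rcases hv.floquet_dichotomy hm hω hP with ⟨-, h⟩ | h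
  · funext t
    rw [h t, hc]
    push_cast
    rfl
  · rw [Complex.ofReal_re] at h
    exact absurd h hl.ne'

theorem IsPeriodicRiccati.isMaxExponent (hv : IsPeriodicRiccati m γ ε ω l v) (hm : 0 < m)
    (hω : 0 < ω) (hl : -l - γ / m < l) : IsMaxExponent m γ ε ω l := by
  refine ⟨⟨_, hv.isFloquetFactor hm one_ne_zero⟩, ?_⟩
  rintro μ ⟨P, hP⟩
  rcases hv.floquet_dichotomy hm hω hP with ⟨h, -⟩ | h
  · exact h.le
  · exact h.le.trans hl.le

/-- Time reversal exchanges the periodic factors of the two exponents `l` and `-l - γ / m`. -/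
theorem IsFloquetFactor.reverse (hm : 0 < m) {P : ℝ → ℂ} (hP : IsFloquetFactor m γ ε ω (l : ℂ) P) :
    IsFloquetFactor m γ ε ω ((-l - γ / m : ℝ) : ℂ) (fun t => P (-t)) := by
  push_cast
  exact hP.comp_neg hm

theorem IsFloquetFactor.of_reverse (hm : 0 < m) {P : ℝ → ℂ}
    (hP : IsFloquetFactor m γ ε ω ((-l - γ / m : ℝ) : ℂ) P) :
    IsFloquetFactor m γ ε ω (l : ℂ) (fun t => P (-t)) := by
  have h := hP.reverse hm
  rwa [show -(-l - γ / m) - γ / m = l by ring] at h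

theorem IsPeriodicRiccati.isMinExponent (hv : IsPeriodicRiccati m γ ε ω l v) (hm : 0 < m)
    (hω : 0 < ω) (hl : -l - γ / m < l) : IsMinExponent m γ ε ω (-l - γ / m) := by
  refine ⟨⟨_, (hv.isFloquetFactor hm one_ne_zero).reverse hm⟩, ?_⟩
  rintro μ ⟨P, hP⟩
  rcases hv.floquet_dichotomy hm hω hP with ⟨h, -⟩ | h
  · exact hl.le.trans h.ge
  · exact h.ge

theorem wkbMax_pos {t : ℝ} (hQ : 0 < γ ^ 2 / 4 + m * ε * Real.cos (ω * t)) :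
    0 < wkbMax m γ ε ω t := by
  rw [wkbMax_eq_exp hQ]
  exact Real.exp_pos _

/-- On one period the logarithms of the periodic factor and of `wkbMax` differ by the integral of
`r` minus its mean, hence by at most `2 δ` times the period. -/
theorem abs_factor_sub_wkbMax_le {M δ : ℝ} {r : ℝ → ℝ} (hγ : 0 < γ) (hω : 0 < ω)
    (hQ : ∀ t, 0 < γ ^ 2 / 4 + m * ε * Real.cos (ω * t)) (hr : Continuous r)
    (hrδ : ∀ t, |r t| ≤ δ) (hlδ : |l| ≤ δ) (hM : ∀ t, wkbMax m γ ε ω t ≤ M)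
    (hsmall : 2 * δ * (2 * Real.pi / ω) ≤ 1) {t : ℝ}
    (ht : t ∈ Set.Ico 0 (2 * Real.pi / ω)) :
    |wkbMax m γ ε ω 0 * Real.exp ((∫ s in (0 : ℝ)..t, (wkbSlope m γ ε ω s + r s)) - l * t)
      - wkbMax m γ ε ω t| ≤ M * (4 * δ * (2 * Real.pi / ω)) := by
  have hδ : 0 ≤ δ := (abs_nonneg _).trans hlδ
  set h := (∫ s in (0 : ℝ)..t, r s) - l * t with hh
  have hbound : |h| ≤ 2 * δ * (2 * Real.pi / ω) := by
    have e1 := intervalIntegral.norm_integral_le_of_norm_le_const (a := 0) (b := t)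
      (f := r) fun t _ => hrδ t
    rw [sub_zero, abs_of_nonneg ht.1, Real.norm_eq_abs] at e1
    have e2 : |l * t| ≤ δ * t := by
      rw [abs_mul, abs_of_nonneg ht.1]
      exact mul_le_mul_of_nonneg_right hlδ ht.1
    have e3 := abs_sub (∫ s in (0 : ℝ)..t, r s) (l * t)
    have e4 : δ * t ≤ δ * (2 * Real.pi / ω) := mul_le_mul_of_nonneg_left ht.2.le hδ
    linarith
  have heq : wkbMax m γ ε ω 0
      * Real.exp ((∫ s in (0 : ℝ)..t, (wkbSlope m γ ε ω s + r s)) - l * t)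
      = wkbMax m γ ε ω t * Real.exp h := by
    rw [intervalIntegral.integral_add ((continuous_wkbSlope hQ).intervalIntegrable _ _)
      (hr.intervalIntegrable _ _), integral_wkbSlope hγ hω hQ, wkbMax_eq_exp (hQ 0),
      wkbMax_eq_exp (hQ t), ← Real.exp_add, ← Real.exp_add, hh]
    ring_nf
  rw [heq, show wkbMax m γ ε ω t * Real.exp h - wkbMax m γ ε ω t
    = wkbMax m γ ε ω t * (Real.exp h - 1) by ring, abs_mul, abs_of_pos (wkbMax_pos (hQ t))]
  have h2 := Real.abs_exp_sub_one_le (hbound.trans hsmall)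
  refine mul_le_mul (hM t) (h2.trans ?_) (abs_nonneg _) ((wkbMax_pos (hQ t)).le.trans (hM t))
  linarith

/-- All the smallness requirements on `m`, for a fixed frequency. -/
theorem exists_mass_threshold {γ : ℝ} (hγ : 0 < γ) (ε ω G F K : ℝ) (hF : 0 < F) :
    ∃ m₀ : ℝ, 0 < m₀ ∧ ∀ m : ℝ, 0 < m → m < m₀ →
      m * |ε| ≤ γ ^ 2 / 8 ∧ m * (2 * |ε| * ω / γ ^ 2) ≤ 1 ∧
      m * (8 * ε ^ 2 * ω / γ ^ 3 + 2 * |ε| * ω ^ 2 / γ ^ 2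
        + m * (16 * ε ^ 2 * ω ^ 2 / γ ^ 4)) ≤ 1 ∧
      2 * G * (K * m) + (K * m) ^ 2 ≤ F ∧ m * (2 * G + 2 * (K * m)) < γ ∧
      2 * (K * m) * (2 * Real.pi / ω) ≤ 1 := by
  have key : ∀ {φ : ℝ → ℝ} {c : ℝ}, Continuous φ → φ 0 < c → ∀ᶠ m in nhds 0, φ m < c :=
    fun hφ hc => (hφ.tendsto 0).eventually_lt_const hc
  have ev := (key (φ := fun m => m * |ε|) (c := γ ^ 2 / 8) (by fun_prop)
      (by simp only [zero_mul]; positivity)).and <|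
    (key (φ := fun m => m * (2 * |ε| * ω / γ ^ 2)) (c := 1) (by fun_prop) (by simp)).and <|
    (key (φ := fun m => m * (8 * ε ^ 2 * ω / γ ^ 3 + 2 * |ε| * ω ^ 2 / γ ^ 2
        + m * (16 * ε ^ 2 * ω ^ 2 / γ ^ 4))) (c := 1) (by fun_prop) (by simp)).and <|
    (key (φ := fun m => 2 * G * (K * m) + (K * m) ^ 2) (c := F) (by fun_prop)
      (by simpa using hF)).and <|
    (key (φ := fun m => m * (2 * G + 2 * (K * m))) (c := γ) (by fun_prop)
      (by simpa using hγ)).and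
    (key (φ := fun m => 2 * (K * m) * (2 * Real.pi / ω)) (c := 1) (by fun_prop) (by simp))
  obtain ⟨m₀, hm₀, h⟩ := Metric.eventually_nhds_iff.1 ev
  refine ⟨m₀, hm₀, fun m hm hlt => ?_⟩
  obtain ⟨h1, h2, h3, h4, h5, h6⟩ := h (y := m) (by rwa [Real.dist_0_eq_abs, abs_of_pos hm])
  exact ⟨h1.le, h2.le, h3.le, h4.le, h5, h6.le⟩

end Extremal

theorem mainTheorem2 (γ ε ω₀ : ℝ) (hγ : 0 < γ) (hω₀ : 0 < ω₀) :
    ∃ C : ℝ, 0 < C ∧ ∀ ω : ℝ, ω₀ ≤ ω → ∃ m₀ : ℝ, 0 < m₀ ∧ ∀ m : ℝ, 0 < m → m < m₀ →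
      (∀ t : ℝ, 0 < γ ^ 2 / 4 + m * ε * Real.cos (ω * t)) ∧
      ∃ lmin lmax : ℝ, lmin < lmax ∧
        IsMinExponent m γ ε ω lmin ∧ IsMaxExponent m γ ε ω lmax ∧
        (∃! Pmax : ℝ → ℂ,
          IsFloquetFactor m γ ε ω (lmax : ℂ) Pmax ∧ Pmax 0 = (wkbMax m γ ε ω 0 : ℂ)) ∧
        (∃! Pmin : ℝ → ℂ,
          IsFloquetFactor m γ ε ω (lmin : ℂ) Pmin ∧ Pmin 0 = (wkbMin m γ ε ω 0 : ℂ)) ∧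
        (∀ Pmax : ℝ → ℂ, IsFloquetFactor m γ ε ω (lmax : ℂ) Pmax →
          Pmax 0 = (wkbMax m γ ε ω 0 : ℂ) →
          ∀ t : ℝ, ‖Pmax t - (wkbMax m γ ε ω t : ℂ)‖ ≤ C * (m / ω)) ∧
        (∀ Pmin : ℝ → ℂ, IsFloquetFactor m γ ε ω (lmin : ℂ) Pmin →
          Pmin 0 = (wkbMin m γ ε ω 0 : ℂ) →
          ∀ t : ℝ, ‖Pmin t - (wkbMin m γ ε ω t : ℂ)‖ ≤ C * (m / ω)) := by
  -- `G` bounds the slope, `F` its defect, and `K m` the correction to the slope, which is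
  -- twice the defect divided by the damping `γ / m`; `M` bounds `wkbMax`.
  set G : ℝ := |ε| / γ + 1 with hGdef
  set F : ℝ := G ^ 2 + 1 with hFdef
  set K : ℝ := 2 * F / γ with hKdef
  set M : ℝ := (γ ^ 2 / 8) ^ (-(1 / 4) : ℝ) * Real.exp (|ε| / (γ * ω₀)) with hMdef
  have hF : 0 < F := by positivity
  have hK : 0 < K := by positivity
  have hM : 0 < M := by positivity
  refine ⟨M * (4 * K * (2 * Real.pi)), by positivity, fun ω hω => ?_⟩
  have hω' : 0 < ω := hω₀.trans_le hω
  obtain ⟨m₀, hm₀, hsmall⟩ := exists_mass_threshold hγ ε ω G F K hF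
  refine ⟨m₀, hm₀, fun m hm hlt => ?_⟩
  obtain ⟨h1, h2, h3, h4, h5, h6⟩ := hsmall m hm hlt
  have hQ : ∀ t, 0 < γ ^ 2 / 4 + m * ε * Real.cos (ω * t) := fun t =>
    (by positivity : 0 < γ ^ 2 / 8).trans_le (discriminant_lower_bound hm h1 t)
  have hGb : ∀ t, |wkbSlope m γ ε ω t| ≤ G := fun t =>
    (abs_wkbSlope_le hm hγ hω' h1 t).trans (by rw [hGdef]; gcongr)
  have hFb : ∀ t, |wkbDefect m γ ε ω t| ≤ F := fun t => by
    have e1 := abs_wkbDefect_le hm hγ hω' h1 t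
    have e2 := pow_le_pow_left₀ (abs_nonneg _) (hGb t) 2
    linarith
  have hδ : 0 ≤ K * m := by positivity
  have hball : F + 2 * G * (K * m) + (K * m) ^ 2 ≤ γ / m * (K * m) := by
    have e : γ / m * (K * m) = 2 * F := by rw [hKdef]; field_simp
    linarith
  have hcontr : 2 * G + 2 * (K * m) < γ / m := by
    rw [lt_div_iff₀ hm]
    linarith
  obtain ⟨r, l, hrc, hrδ, hlδ, hv⟩ :=
    exists_isPeriodicRiccati hm hγ hω' hδ h1 hGb hFb hball hcontr
  have hl : -l - γ / m < l := by
    have e1 := neg_le_of_abs_le hlδ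
    have e2 : 0 ≤ G := by positivity
    linarith
  have hW0 : wkbMin m γ ε ω 0 = wkbMax m γ ε ω 0 := by rw [wkbMin_eq_wkbMax_neg, neg_zero]
  have hmax : ∀ P : ℝ → ℂ, IsFloquetFactor m γ ε ω (l : ℂ) P → P 0 = (wkbMax m γ ε ω 0 : ℂ) →
      ∀ t : ℝ, ‖P t - (wkbMax m γ ε ω t : ℂ)‖ ≤ M * (4 * K * (2 * Real.pi)) * (m / ω) := by
    intro P hP hP0 t
    have hper : Function.Periodic (fun t => P t - (wkbMax m γ ε ω t : ℂ)) (2 * Real.pi / ω) := by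
      intro t
      simp only [hP.periodic t, wkbMax_eq_exp (hQ _), periodic_wkbLog hω' t]
    obtain ⟨s, hs, hts⟩ := hper.exists_mem_Ico₀ (by positivity) t
    rw [hts, hv.factor_eq hm hω' hl hP hP0, ← Complex.ofReal_sub, Complex.norm_real,
      Real.norm_eq_abs]
    have hWM : ∀ t, wkbMax m γ ε ω t ≤ M := wkbMax_le hm hγ hω₀ hω h1
    refine (abs_factor_sub_wkbMax_le hγ hω' hQ hrc hrδ hlδ hWM h6 hs).trans_eq ?_
    ring
  have hex := hv.isFloquetFactor hm (wkbMax_pos (hQ 0)).ne'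
  refine ⟨hQ, -l - γ / m, l, hl, hv.isMinExponent hm hω' hl, hv.isMaxExponent hm hω' hl,
    ⟨_, ⟨hex, by simp⟩, fun P hP => hv.factor_eq hm hω' hl hP.1 hP.2⟩,
    ⟨_, ⟨hex.reverse hm, by simp [hW0]⟩, fun P hP => ?_⟩, hmax, fun P hP hP0 t => ?_⟩
  · rw [hW0] at hP
    have h := hv.factor_eq hm hω' hl (hP.1.of_reverse hm) (by simpa using hP.2)
    funext t
    simpa using congrFun h (-t)
  · rw [hW0] at hP0
    have h := hmax _ (hP.of_reverse hm) (by simpa using hP0) (-t)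
    rwa [neg_neg, ← wkbMin_eq_wkbMax_neg] at h
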